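/- Let $\alpha$ be an algebraic number over $\mathbb Q$ with monic minimal polynomial $q(T)\in\mathbb Q[T]$, let $n\ge 0$, and let $\mathfrak a$ be an ideal of $R=\mathbb Q(\alpha)[X_1,\dots,X_n]$. Fix polynomials $f_1,\dots,f_m\in\mathbb Z[\alpha][X_1,\dots,X_n]$ that generate $\mathfrak a$ as an ideal of $R$. Consider the primes $p$ such that $p$ divides no denominator of a coefficient of $q$ and $$q(T)\equiv S_1(T)\,S_2(T) \pmod p,\qquad \deg S_1=1,\quad \deg S_2=\deg q-1,\quad \gcd(S_1,S_2)=1 \qquad (*)$$ for some $S_1,S_2\in\mathbb F_p[T]$. For such a $p$ and such a factorization, let $\beta_p\in\mathbb F_p$ be the root of $S_1$, let $\psi_p:\mathbb Z[\alpha]\to\mathbb F_p$ be the (well-defined) ring homomorphism with $\psi_p(\alpha)=\beta_p$, extend it coefficientwise to polynomials, and let $\tilde{\mathfrak a}=(\psi_p(f_1),\dots,\psi_p(f_m))\subseteq R_p=\mathbb F_p[X_1,\dots,X_n]$. For a field $F$ and an ideal $\mathfrak b$ of $S=F[X_1,\dots,X_n]$, the affine Hilbert function of $S/\mathfrak b$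 is $HF^a_{S/\mathfrak b}(i)=\dim_F\big(S_{\le i}/(S_{\le i}\cap\mathfrak b)\big)$ for $i\in\mathbb Z$, where $S_{\le i}$ is the space of polynomials of total degree at most $i$ (so $S_{\le i}=0$ for $i<0$). Then there are only finitely many primes $p$ for which there is a factorization $(*)$ such that $$HF^a_{R/\mathfrak a}(i)\neq HF^a_{R_p/\tilde{\mathfrak a}}(i)\quad\text{for some } i\in\mathbb Z.$$ In other words, for all but finitely many primes $p$ admitting a factorization $(*)$, and for every choice of that factorization, the affine Hilbert functions of $R/\mathfrak a$ and $R_p/\tilde{\mathfrak a}$ are equal. -/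

import Mathlib

open Polynomial

/-- The reduction `q mod p` of a polynomial with rational coefficients: every coefficient `a / b`
(in lowest terms) is replaced by `a * b⁻¹` in `𝔽_p`. It is only used where `p` divides none of the
denominators. -/
noncomputable def reduceModP (p : ℕ) [Fact p.Prime] (q : ℚ[X]) : (ZMod p)[X] :=
  q.sum fun i r => monomial i (r : ZMod p)

/-- The prime `p` is such that `q` has a reduction modulo `p`, and this reduction splits as
`S₁ * S₂` with `deg S₁ = 1`, `deg S₂ = deg q - 1` and `S₁`, `S₂` coprime. -/
structure IsGoodSplitting (p : ℕ) [Fact p.Prime] (q : ℚ[X]) (S₁ S₂ : (ZMod p)[X]) : Prop where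
  not_dvd_den : ∀ i, ¬ p ∣ (q.coeff i).den
  eq_mul : reduceModP p q = S₁ * S₂
  natDegree_left : S₁.natDegree = 1
  natDegree_right : S₂.natDegree + 1 = q.natDegree
  isCoprime : IsCoprime S₁ S₂

/-- The unique root of a polynomial of degree one. -/
noncomputable def linearRoot {F : Type*} [Field F] (S : F[X]) : F :=
  -S.coeff 0 / S.coeff 1

theorem linearRoot_isRoot {F : Type*} [Field F] {S : F[X]} (hS : S.natDegree = 1) :
    S.IsRoot (linearRoot S) := by
  have h1 : S.coeff 1 ≠ 0 := by
    rw [← hS]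
    exact leadingCoeff_ne_zero.mpr (by rintro rfl; simp at hS)
  rw [IsRoot, eval_eq_sum_range, hS, Finset.sum_range_succ, Finset.sum_range_one, linearRoot]
  field_simp
  ring

theorem reduceModP_coeff (p : ℕ) [Fact p.Prime] (q : ℚ[X]) (i : ℕ) :
    (reduceModP p q).coeff i = (q.coeff i : ZMod p) := by
  rw [reduceModP, Polynomial.sum, finsetSum_coeff]
  simp only [coeff_monomial]
  rw [Finset.sum_ite_eq']
  split_ifs with h
  · rfl
  · rw [notMem_support_iff.mp h]; simp

/-- A relation `f(α) = 0` with integer coefficients survives modulo `p`: if `q` is the minimal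
polynomial of `α`, its coefficients are `p`-integral and `β` is a root of `q mod p`, then
`f(β) = 0` in `𝔽_p`. -/
theorem eval₂_eq_zero_of_aeval_eq_zero {K : Type*} [Field K] [CharZero K] {α : K}
    (hα : IsAlgebraic ℚ α) {p : ℕ} [Fact p.Prime]
    (hden : ∀ i, ¬ p ∣ ((minpoly ℚ α).coeff i).den) {β : ZMod p}
    (hβ : (reduceModP p (minpoly ℚ α)).IsRoot β) (f : ℤ[X]) (hf : aeval α f = 0) :
    f.eval₂ (Int.castRingHom (ZMod p)) β = 0 := by
  set q := minpoly ℚ α with hq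
  have hmonic : q.Monic := minpoly.monic hα.isIntegral
  -- the polynomial `q` over the `p`-adic integers
  obtain ⟨Q, hQ⟩ : ∃ Q : ℤ_[p][X],
      Q.map PadicInt.Coe.ringHom = q.map (algebraMap ℚ ℚ_[p]) := by
    have : q.map (algebraMap ℚ ℚ_[p]) ∈ Polynomial.lifts (PadicInt.Coe.ringHom (p := p)) := by
      rw [Polynomial.lifts_iff_coeff_lifts]
      intro i
      refine ⟨⟨((q.coeff i : ℚ) : ℚ_[p]), Padic.norm_rat_le_one (hden i)⟩, ?_⟩
      rw [coeff_map, eq_ratCast]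
      rfl
    rw [Polynomial.mem_lifts] at this
    exact this
  have hinj : Function.Injective (PadicInt.Coe.ringHom (p := p)) := Subtype.val_injective
  have hQmonic : Q.Monic := by
    refine Polynomial.monic_of_injective hinj ?_
    rw [hQ]
    exact hmonic.map _
  have hQred : Q.map PadicInt.toZMod = reduceModP p q := by
    ext i
    rw [coeff_map, reduceModP_coeff, Rat.cast_def]
    have hd : ((q.coeff i).den : ZMod p) ≠ 0 := by
      rw [Ne, ZMod.natCast_eq_zero_iff]
      exact hden i
    rw [eq_div_iff hd]
    have h1 : Q.coeff i * ((q.coeff i).den : ℤ_[p]) = ((q.coeff i).num : ℤ_[p]) := by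
      apply hinj
      have h2 := congrArg (fun P => P.coeff i) hQ
      simp only [coeff_map] at h2
      rw [map_mul, h2, map_natCast, map_intCast]
      rw [eq_ratCast]
      exact_mod_cast Rat.mul_den_eq_num (q.coeff i)
    have h4 := congrArg (PadicInt.toZMod (p := p)) h1
    simpa using h4
  have hdvd : q ∣ f.map (Int.castRingHom ℚ) := by
    apply minpoly.dvd
    rw [← hf, aeval_def, aeval_def, eval₂_map]
    congr 1
    exact RingHom.ext_int _ _
  have hdvd2 : Q ∣ f.map (Int.castRingHom ℤ_[p]) := by
    rw [← Polynomial.map_dvd_map _ hinj hQmonic, hQ, map_map]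
    have h5 := Polynomial.map_dvd (algebraMap ℚ ℚ_[p]) hdvd
    rw [map_map] at h5
    rwa [RingHom.ext_int ((algebraMap ℚ ℚ_[p]).comp (Int.castRingHom ℚ))
      (PadicInt.Coe.ringHom.comp (Int.castRingHom ℤ_[p]))] at h5
  have hdvd3 : reduceModP p q ∣ f.map (Int.castRingHom (ZMod p)) := by
    have h6 := Polynomial.map_dvd (PadicInt.toZMod (p := p)) hdvd2
    rw [hQred, map_map] at h6
    convert h6 using 2
    exact RingHom.ext_int _ _
  have h7 := hβ.dvd hdvd3
  rwa [IsRoot, eval_map] at h7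

/-- The generator `α` of the ring `ℤ[α]`. -/
def adjoinGen {K : Type*} [Field K] (α : K) : Algebra.adjoin ℤ ({α} : Set K) :=
  ⟨α, Algebra.subset_adjoin rfl⟩

/-- The surjection `ℤ[T] → ℤ[α]`, `T ↦ α`. -/
noncomputable def evalAtGen {K : Type*} [Field K] (α : K) :
    ℤ[X] →+* Algebra.adjoin ℤ ({α} : Set K) :=
  (aeval (adjoinGen α)).toRingHom

theorem coe_evalAtGen {K : Type*} [Field K] (α : K) (f : ℤ[X]) :
    (evalAtGen α f : K) = aeval α f := by
  have := (aeval_algHom_apply (Algebra.adjoin ℤ ({α} : Set K)).val (adjoinGen α) f).symm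
  exact this

theorem evalAtGen_surjective {K : Type*} [Field K] (α : K) :
    Function.Surjective (evalAtGen α) := by
  rintro ⟨x, hx⟩
  have hx' := hx
  rw [Algebra.adjoin_singleton_eq_range_aeval] at hx'
  obtain ⟨f, hf⟩ := hx'
  exact ⟨f, Subtype.ext ((coe_evalAtGen α f).trans hf)⟩

/-- The ring homomorphism `ψ_p : ℤ[α] → 𝔽_p` with `α ↦ β_p`, where `β_p` is the root of the linear
factor `S₁` of the minimal polynomial of `α` modulo `p`: it sends `f(α)` to `f(β_p)`. -/
noncomputable def psi {K : Type*} [Field K] [CharZero K] {α : K} (hα : IsAlgebraic ℚ α)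
    {p : ℕ} [Fact p.Prime] {S₁ S₂ : (ZMod p)[X]}
    (h : IsGoodSplitting p (minpoly ℚ α) S₁ S₂) :
    Algebra.adjoin ℤ ({α} : Set K) →+* ZMod p :=
  (evalAtGen α).liftOfSurjective (evalAtGen_surjective α)
    ⟨eval₂RingHom (Int.castRingHom (ZMod p)) (linearRoot S₁), by
      intro f hf
      rw [RingHom.mem_ker] at hf ⊢
      refine eval₂_eq_zero_of_aeval_eq_zero hα h.not_dvd_den ?_ f ?_
      · rw [h.eq_mul]
        exact (linearRoot_isRoot h.natDegree_left).dvd (dvd_mul_right _ _)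
      · rw [← coe_evalAtGen, hf]
        rfl⟩

/-- `ψ_p(α) = β_p`. -/
theorem psi_adjoinGen {K : Type*} [Field K] [CharZero K] {α : K} (hα : IsAlgebraic ℚ α)
    {p : ℕ} [Fact p.Prime] {S₁ S₂ : (ZMod p)[X]}
    (h : IsGoodSplitting p (minpoly ℚ α) S₁ S₂) :
    psi hα h (adjoinGen α) = linearRoot S₁ := by
  have h1 : evalAtGen α X = adjoinGen α := aeval_X _
  rw [← h1, psi, RingHom.liftOfRightInverse_comp_apply]
  exact eval₂_X _ _

/-- The space `R_{≤ i}` of the polynomials of degree at most `i` (zero for `i < 0`). -/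
noncomputable def polyLE (n : ℕ) (F : Type*) [Field F] (i : ℤ) : Submodule F (MvPolynomial (Fin n) F) :=
  MvPolynomial.restrictSupport F {m | (m.degree : ℤ) ≤ i}

/-- The affine Hilbert function `i ↦ dim_F (R_{≤ i} / 𝔞_{≤ i})` of `R / 𝔞`, where
`R = F[X₁, …, X_n]` and `𝔞_{≤ i} = R_{≤ i} ∩ 𝔞`. -/
noncomputable def affineHilbertFunction {n : ℕ} {F : Type*} [Field F]
    (𝔞 : Ideal (MvPolynomial (Fin n) F)) (i : ℤ) : ℤ :=
  Module.finrank F (polyLE n F i ⧸ (𝔞.restrictScalars F).submoduleOf (polyLE n F i))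

/-- The reduction `𝔞~ = (f~₁, …, f~_m)` in `𝔽_p[X₁, …, X_n]` of the ideal generated by polynomials
`f₁, …, f_m` with coefficients in `ℤ[α]`, where `f~` is `f` with `ψ_p` applied to its
coefficients. -/
noncomputable def reducedIdeal {K : Type*} [Field K] [CharZero K] {α : K}
    (hα : IsAlgebraic ℚ α) {p : ℕ} [Fact p.Prime] {S₁ S₂ : (ZMod p)[X]}
    (h : IsGoodSplitting p (minpoly ℚ α) S₁ S₂) {n m : ℕ}
    (f : Fin m → MvPolynomial (Fin n) (Algebra.adjoin ℤ ({α} : Set K))) :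
    Ideal (MvPolynomial (Fin n) (ZMod p)) :=
  Ideal.span (Set.range fun j => MvPolynomial.map (psi hα h) (f j))

/-!
The proof is generic constancy of the affine Hilbert function, made explicit by Gröbner bases.

Let `A = ℤ[α]` and `I = (f₁, …, f_m) ⊆ A[X₁, …, X_n]`. By Dickson's lemma finitely many elements of
`I` have, for the degree-lexicographic order, leading exponents dividing all leading exponents of
`I`; let `D ≠ 0` be the product of their leading coefficients. Over `B = A[1/D]` division by these
elements is possible, so `B[X₁, …, X_n]` is the direct sum of `I B[X₁, …, X_n]` and the free module
on the normal monomials (those divisible by no leading exponent), compatibly with the filtration by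
total degree (`exists_hasNormalForms_localizationAway`). Such a decomposition persists under every
base change `B → F` (`HasNormalForms.map`), and over a field it shows that the affine Hilbert
function counts normal monomials (`HasNormalForms.affineHilbertFunction_eq`). Applied to `A → K` and
to `ψ_p : A → 𝔽_p`, this gives equality of the two functions, in all degrees at once, whenever
`ψ_p D ≠ 0`. As `D` is algebraic over `ℤ`, it divides a nonzero integer
(`exists_int_ne_zero_dvd`), and `ψ_p D = 0` forces `p` to divide that integer.
-/

/-! ### Normal forms modulo an ideal and base change -/

/-- `HasNormalForms I N` says that the monomials with exponent in `N` form a basis of the quotient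
by `I`, compatibly with the filtration by total degree: every monomial is congruent modulo `I` to a
combination of monomials with exponents in `N` of no larger degree, and no nonzero such combination
lies in `I`. -/
structure HasNormalForms {n : ℕ} {B : Type*} [CommRing B] (I : Ideal (MvPolynomial (Fin n) B))
    (N : Set (Fin n →₀ ℕ)) : Prop where
  exists_remainder : ∀ t : Fin n →₀ ℕ, ∃ r : MvPolynomial (Fin n) B,
    MvPolynomial.monomial t 1 - r ∈ I ∧ ∀ s ∈ r.support, s ∈ N ∧ s.degree ≤ t.degree
  eq_zero : ∀ x ∈ I, (∀ s ∈ x.support, s ∈ N) → x = 0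

/-- Over a field, the affine Hilbert function counts the normal monomials. -/
theorem HasNormalForms.affineHilbertFunction_eq {n : ℕ} {F : Type*} [Field F]
    {J : Ideal (MvPolynomial (Fin n) F)} {N : Set (Fin n →₀ ℕ)} (h : HasNormalForms J N) (i : ℤ) :
    affineHilbertFunction J i = Nat.card ↥(N ∩ {t | (t.degree : ℤ) ≤ i}) := by
  set W := MvPolynomial.restrictSupport F (N ∩ {t : Fin n →₀ ℕ | (t.degree : ℤ) ≤ i}) with hW
  have hWV : W ≤ polyLE n F i := MvPolynomial.restrictSupport_mono F Set.inter_subset_right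
  have hsup : polyLE n F i ≤ (J.restrictScalars F ⊓ polyLE n F i) ⊔ W := by
    suffices Submodule.span F ((MvPolynomial.monomial · 1) '' {t : Fin n →₀ ℕ | (t.degree : ℤ) ≤ i})
        ≤ (J.restrictScalars F ⊓ polyLE n F i) ⊔ W by
      rwa [← MvPolynomial.restrictSupport_eq_span] at this
    rw [Submodule.span_le]
    rintro _ ⟨t, ht, rfl⟩
    obtain ⟨r, hr, hs⟩ := h.exists_remainder t
    have hrW : r ∈ W := by
      rw [hW, MvPolynomial.mem_restrictSupport_iff]
      intro s hsr
      refine ⟨(hs s hsr).1, ?_⟩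
      have := (hs s hsr).2
      simp only [Set.mem_ofPred_eq] at ht ⊢
      omega
    change MvPolynomial.monomial t 1 ∈ _
    rw [← sub_add_cancel (MvPolynomial.monomial t (1 : F)) r]
    refine Submodule.add_mem_sup ⟨hr, Submodule.sub_mem _ ?_ (hWV hrW)⟩ hrW
    exact (MvPolynomial.monomial_mem_restrictSupport F).mpr (Or.inl ht)
  have hcompl : IsCompl ((J.restrictScalars F).submoduleOf (polyLE n F i))
      (W.submoduleOf (polyLE n F i)) := by
    refine ⟨Submodule.disjoint_def.mpr ?_, codisjoint_iff_le_sup.mpr ?_⟩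
    · intro x hxJ hxW
      exact Subtype.ext (h.eq_zero _ hxJ fun s hs => (hxW hs).1)
    · rintro ⟨x, hx⟩ -
      obtain ⟨y, ⟨hyJ, hyV⟩, w, hw, rfl⟩ := Submodule.mem_sup.mp (hsup hx)
      exact Submodule.mem_sup.mpr ⟨⟨y, hyV⟩, hyJ, ⟨w, hWV hw⟩, hw, rfl⟩
  rw [affineHilbertFunction, ((Submodule.quotientEquivOfIsCompl _ _ hcompl).trans
    (Submodule.submoduleOfEquivOfLe hWV)).finrank_eq,
    Module.finrank_eq_nat_card_basis (MvPolynomial.basisRestrictSupport F _)]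

/-- Normal forms persist under base change: the projection onto the normal monomials is linear over
the base ring, kills `I`, and is given on monomials by formulas that can be mapped to `F`. -/
theorem HasNormalForms.map {n : ℕ} {B F : Type*} [CommRing B] [CommRing F]
    {I : Ideal (MvPolynomial (Fin n) B)} {N : Set (Fin n →₀ ℕ)} (h : HasNormalForms I N)
    (ψ : B →+* F) : HasNormalForms (I.map (MvPolynomial.map ψ)) N := by
  classical
  choose r hrI hrN using h.exists_remainder
  -- `P` is the projection onto the normal monomials along `I`, and `Q` its base change.
  let P : MvPolynomial (Fin n) B →ₗ[B] MvPolynomial (Fin n) B :=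
    (MvPolynomial.basisMonomials (Fin n) B).constr B r
  let Q : MvPolynomial (Fin n) F →ₗ[F] MvPolynomial (Fin n) F :=
    (MvPolynomial.basisMonomials (Fin n) F).constr F fun t => MvPolynomial.map ψ (r t)
  have hP (t c) : P (MvPolynomial.monomial t c) = c • r t := by
    have := (MvPolynomial.basisMonomials (Fin n) B).constr_basis B r t
    rw [MvPolynomial.coe_basisMonomials] at this
    rw [← mul_one c, ← smul_eq_mul, ← MvPolynomial.smul_monomial, map_smul, this, smul_eq_mul,
      mul_one]
  have hQ (t c) : Q (MvPolynomial.monomial t c) = c • MvPolynomial.map ψ (r t) := by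
    have := (MvPolynomial.basisMonomials (Fin n) F).constr_basis F
      (fun t => MvPolynomial.map ψ (r t)) t
    rw [MvPolynomial.coe_basisMonomials] at this
    rw [← mul_one c, ← smul_eq_mul, ← MvPolynomial.smul_monomial, map_smul, this, smul_eq_mul,
      mul_one]
  have hPI (x) : x - P x ∈ I ∧ P x ∈ MvPolynomial.restrictSupport B N := by
    induction x using MvPolynomial.induction_on' with
    | monomial t c =>
      refine ⟨?_, ?_⟩
      · have : MvPolynomial.monomial t c - P (MvPolynomial.monomial t c)
            = MvPolynomial.C c * (MvPolynomial.monomial t 1 - r t) := by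
          rw [hP, mul_sub, MvPolynomial.C_mul_monomial, mul_one, MvPolynomial.C_mul']
        rw [this]
        exact I.mul_mem_left _ (hrI t)
      · rw [hP]
        exact Submodule.smul_mem _ _ fun s hs => (hrN t s hs).1
    | add x y hx hy =>
      rw [map_add, add_sub_add_comm]
      exact ⟨I.add_mem hx.1 hy.1, Submodule.add_mem _ hx.2 hy.2⟩
  have hPzero (x) (hx : x ∈ I) : P x = 0 := by
    refine h.eq_zero _ ?_ fun s hs => (hPI x).2 hs
    rw [← sub_sub_cancel x (P x)]
    exact I.sub_mem hx (hPI x).1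
  have hrfix (t) (ht : t ∈ N) : r t = MvPolynomial.monomial t 1 := by
    refine (sub_eq_zero.mp (h.eq_zero _ (hrI t) fun s hs => ?_)).symm
    rcases Finset.mem_union.mp (MvPolynomial.support_sub _ _ _ hs) with hs | hs
    · rw [Finset.mem_singleton.mp (MvPolynomial.support_monomial_subset hs)]
      exact ht
    · exact (hrN t s hs).1
  have hQP (x) : Q (MvPolynomial.map ψ x) = MvPolynomial.map ψ (P x) := by
    induction x using MvPolynomial.induction_on' with
    | monomial t c =>
      rw [MvPolynomial.map_monomial, hQ, hP, MvPolynomial.smul_eq_C_mul,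
        MvPolynomial.smul_eq_C_mul, map_mul, MvPolynomial.map_C]
    | add x y hx hy => simp only [map_add, hx, hy]
  have hQzero (x) (hx : x ∈ I.map (MvPolynomial.map ψ)) : Q x = 0 := by
    -- `Q` is only `F`-linear, so the multipliers `y` are carried through the induction.
    refine Submodule.span_induction (p := fun x _ => ∀ y, Q (y * x) = 0) ?_ (by simp)
      (fun x y _ _ hx hy z => by rw [mul_add, map_add, hx, hy, add_zero])
      (fun a x _ hx z => by rw [smul_eq_mul, ← mul_assoc, hx]) hx 1 |> fun h => by rwa [one_mul] at h
    rintro _ ⟨x, hx, rfl⟩ y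
    induction y using MvPolynomial.induction_on' with
    | monomial t c =>
      have : MvPolynomial.monomial t c * MvPolynomial.map ψ x
          = c • MvPolynomial.map ψ (MvPolynomial.monomial t 1 * x) := by
        rw [map_mul, MvPolynomial.map_monomial, map_one, ← smul_mul_assoc,
          MvPolynomial.smul_monomial, smul_eq_mul, mul_one]
      change Q (MvPolynomial.monomial t c * MvPolynomial.map ψ x) = 0
      rw [this, map_smul, hQP, hPzero _ (I.mul_mem_left _ hx), map_zero, smul_zero]
    | add y z hy hz => rw [add_mul, map_add, hy, hz, add_zero]
  refine ⟨fun t => ⟨MvPolynomial.map ψ (r t), ?_, fun s hs => hrN t s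
    (MvPolynomial.support_map_subset _ _ hs)⟩, fun x hx hxN => ?_⟩
  · have := Ideal.mem_map_of_mem (MvPolynomial.map ψ) (hrI t)
    rwa [map_sub, MvPolynomial.map_monomial, map_one] at this
  · rw [← hQzero x hx]
    conv_lhs => rw [x.as_sum]
    conv_rhs => rw [x.as_sum, map_sum]
    refine Finset.sum_congr rfl fun t ht => ?_
    rw [hQ, hrfix t (hxN t ht), MvPolynomial.map_monomial, map_one, MvPolynomial.smul_monomial,
      smul_eq_mul, mul_one]

/-! ### Gröbner bases over a localization -/

/-- By Dickson's lemma, finitely many leading exponents suffice to divide all leading exponents of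
an ideal. -/
theorem exists_finset_forall_degLex_degree_le {n : ℕ} {A : Type*} [CommRing A]
    (I : Ideal (MvPolynomial (Fin n) A)) :
    ∃ G : Finset (MvPolynomial (Fin n) A), (∀ g ∈ G, g ∈ I ∧ g ≠ 0) ∧
      ∀ x ∈ I, x ≠ 0 → ∃ g ∈ G, MonomialOrder.degLex.degree g ≤ MonomialOrder.degLex.degree x := by
  classical
  let S : Set (MvPolynomial (Fin n) A) := {x | x ∈ I ∧ x ≠ 0}
  let P : (Fin n →₀ ℕ) → Prop := (· ∈ MonomialOrder.degLex.degree '' S)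
  have hfin : {t | Minimal P t}.Finite :=
    WellQuasiOrderedLE.finite_of_isAntichain (setOfPred_minimal_antichain P)
  have hsub : (hfin.toFinset : Set (Fin n →₀ ℕ)) ⊆ MonomialOrder.degLex.degree '' S := by
    rw [hfin.coe_toFinset]
    exact fun t ht => ht.prop
  obtain ⟨G, hGS, hG⟩ := Finset.subset_set_image_iff.mp hsub
  refine ⟨G, fun g hg => hGS hg, fun x hx hx0 => ?_⟩
  obtain ⟨t, htx, ht⟩ := exists_minimal_le_of_wellFoundedLT P _ ⟨x, ⟨hx, hx0⟩, rfl⟩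
  have : t ∈ G.image MonomialOrder.degLex.degree := by
    rw [hG, hfin.mem_toFinset]
    exact ht
  obtain ⟨g, hg, rfl⟩ := Finset.mem_image.mp this
  exact ⟨g, hg, htx⟩

/-- Elements of an ideal whose leading coefficients are units and whose leading exponents divide all
leading exponents of the ideal yield normal forms, by the division algorithm; the order `degLex`
refines the total degree, so that remainders do not grow in degree. -/
theorem hasNormalForms_of_isUnit_leadingCoeff {n : ℕ} {B : Type*} [CommRing B] [Nontrivial B]
    {I : Ideal (MvPolynomial (Fin n) B)} (G : Set (MvPolynomial (Fin n) B)) (hGI : G ⊆ I)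
    (hunit : ∀ g ∈ G, IsUnit (MonomialOrder.degLex.leadingCoeff g))
    (hlead : ∀ x ∈ I, x ≠ 0 →
      ∃ g ∈ G, MonomialOrder.degLex.degree g ≤ MonomialOrder.degLex.degree x) :
    HasNormalForms I {t | ∀ g ∈ G, ¬ MonomialOrder.degLex.degree g ≤ t} := by
  classical
  refine ⟨fun t => ?_, fun x hx hxN => ?_⟩
  · obtain ⟨q, r, hqr, hdeg, hr⟩ :=
      MonomialOrder.degLex.div_set hunit (MvPolynomial.monomial t (1 : B))
    have hsum : MvPolynomial.monomial t (1 : B) - r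
        = Finsupp.linearCombination _ (fun b : G => (b : MvPolynomial (Fin n) B)) q := by
      rw [hqr, add_sub_cancel_right]
    have hle : MonomialOrder.degLex.toSyn (MonomialOrder.degLex.degree r)
        ≤ MonomialOrder.degLex.toSyn t := by
      have hmon : MonomialOrder.degLex.degree (MvPolynomial.monomial t (1 : B)) = t := by
        rw [MonomialOrder.degree_monomial, if_neg one_ne_zero]
      rw [hmon] at hdeg
      rw [← sub_sub_cancel (MvPolynomial.monomial t (1 : B)) r, hsum]
      refine MonomialOrder.degree_sub_le.trans (sup_le (by rw [hmon]) ?_)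
      rw [Finsupp.linearCombination_apply, Finsupp.sum]
      refine MonomialOrder.degree_sum_le.trans (Finset.sup_le fun b _ => ?_)
      rw [smul_eq_mul, mul_comm]
      exact hdeg b
    refine ⟨r, ?_, fun s hs => ⟨fun g hg => hr s hs g hg, ?_⟩⟩
    · rw [hsum, Finsupp.linearCombination_apply]
      exact I.sum_mem fun b _ => I.mul_mem_left _ (hGI b.2)
    · exact Finsupp.DegLex.monotone_degree ((MonomialOrder.degLex.le_degree hs).trans hle)
  · by_contra hx0
    obtain ⟨g, hg, hle⟩ := hlead x hx hx0
    exact hxN _ (MonomialOrder.degLex.degree_mem_support hx0) g hg hle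

theorem degLex_degree_map_of_injective {n : ℕ} {A B : Type*} [CommRing A] [CommRing B]
    {φ : A →+* B} (hφ : Function.Injective φ) (x : MvPolynomial (Fin n) A) :
    MonomialOrder.degLex.degree (MvPolynomial.map φ x) = MonomialOrder.degLex.degree x := by
  rw [MonomialOrder.degree, MonomialOrder.degree, MvPolynomial.support_map_of_injective _ hφ]

/-- Inverting the leading coefficients of a finite Gröbner basis gives normal forms. -/
theorem exists_hasNormalForms_localizationAway {n : ℕ} {A : Type*} [CommRing A] [IsDomain A]
    (I : Ideal (MvPolynomial (Fin n) A)) :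
    ∃ D : A, D ≠ 0 ∧ ∃ N : Set (Fin n →₀ ℕ),
      HasNormalForms (I.map (MvPolynomial.map (algebraMap A (Localization.Away D)))) N := by
  classical
  -- The leading exponents are those of `I` itself; clearing powers of `D` shows that they are also
  -- the leading exponents of the localized ideal.
  obtain ⟨G, hG, hlead⟩ := exists_finset_forall_degLex_degree_le I
  let D : A := ∏ g ∈ G, MonomialOrder.degLex.leadingCoeff g
  have hD : D ≠ 0 := Finset.prod_ne_zero_iff.mpr fun g hg =>
    MonomialOrder.degLex.leadingCoeff_ne_zero_iff.mpr (hG g hg).2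
  have hpow : Submonoid.powers D ≤ nonZeroDivisors A :=
    powers_le_nonZeroDivisors_of_noZeroDivisors hD
  have hinj : Function.Injective (algebraMap A (Localization.Away D)) :=
    IsLocalization.injective _ hpow
  have : IsDomain (Localization.Away D) := IsLocalization.isDomain_localization hpow
  refine ⟨D, hD, _, hasNormalForms_of_isUnit_leadingCoeff
    (MvPolynomial.map (algebraMap A (Localization.Away D)) '' G) ?_ ?_ ?_⟩
  · rintro _ ⟨g, hg, rfl⟩
    exact Ideal.mem_map_of_mem _ (hG g hg).1
  · rintro _ ⟨g, hg, rfl⟩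
    rw [MonomialOrder.leadingCoeff, degLex_degree_map_of_injective hinj, MvPolynomial.coeff_map]
    exact isUnit_of_dvd_unit (map_dvd _ (Finset.dvd_prod_of_mem MonomialOrder.degLex.leadingCoeff hg))
      (IsLocalization.Away.algebraMap_isUnit D)
  · intro x hx hx0
    rw [← MvPolynomial.algebraMap_def,
      IsLocalization.mem_map_algebraMap_iff ((Submonoid.powers D).map MvPolynomial.C)] at hx
    obtain ⟨⟨⟨y, hy⟩, ⟨_, s, hs, rfl⟩⟩, hxy⟩ := hx
    simp only [MvPolynomial.algebraMap_def, MvPolynomial.map_C] at hxy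
    have hs0 : algebraMap A (Localization.Away D) s ≠ 0 :=
      (IsLocalization.map_units (Localization.Away D) (⟨s, hs⟩ : Submonoid.powers D)).ne_zero
    have hC0 : (MvPolynomial.C (algebraMap A (Localization.Away D) s) :
        MvPolynomial (Fin n) (Localization.Away D)) ≠ 0 := by
      rwa [Ne, MvPolynomial.C_eq_zero]
    have hy0 : y ≠ 0 := by
      rintro rfl
      rw [map_zero] at hxy
      exact mul_ne_zero hx0 hC0 hxy
    obtain ⟨g, hg, hle⟩ := hlead y hy hy0
    refine ⟨_, ⟨g, hg, rfl⟩, ?_⟩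
    have hdeg := congrArg MonomialOrder.degLex.degree hxy
    rw [MonomialOrder.degree_mul hx0 hC0, MonomialOrder.degree_C, add_zero,
      degLex_degree_map_of_injective hinj] at hdeg
    rwa [degLex_degree_map_of_injective hinj, hdeg]

/-- If `I` has normal forms after inverting `D`, its base change along any map to a field under which
`D` survives has the affine Hilbert function that counts the normal monomials. -/
theorem affineHilbertFunction_map_eq_card {n : ℕ} {A : Type*} [CommRing A]
    {I : Ideal (MvPolynomial (Fin n) A)} {D : A} {N : Set (Fin n →₀ ℕ)}
    (hN : HasNormalForms (I.map (MvPolynomial.map (algebraMap A (Localization.Away D)))) N)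
    {F : Type*} [Field F] (ψ : A →+* F) (hψ : ψ D ≠ 0) (i : ℤ) :
    affineHilbertFunction (I.map (MvPolynomial.map ψ)) i
      = Nat.card ↥(N ∩ {t | (t.degree : ℤ) ≤ i}) := by
  have hcomp : (MvPolynomial.map
      (IsLocalization.Away.lift (S := Localization.Away D) D hψ.isUnit)).comp
      (MvPolynomial.map (algebraMap A (Localization.Away D)))
      = MvPolynomial.map (σ := Fin n) ψ := by
    refine MvPolynomial.ringHom_ext (fun x => ?_) fun j => ?_
    · simp
    · simp
  have h := hN.map (IsLocalization.Away.lift (S := Localization.Away D) D hψ.isUnit)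
  rw [Ideal.map_map, hcomp] at h
  exact h.affineHilbertFunction_eq i

/-! ### Specialization of `ℤ[α]` -/

/-- A nonzero element of `ℤ[α]` divides a nonzero integer in `ℤ[α]`. -/
theorem exists_int_ne_zero_dvd {K : Type*} [Field K] [CharZero K] {α : K} (hα : IsAlgebraic ℚ α)
    {D : Algebra.adjoin ℤ ({α} : Set K)} (hD : D ≠ 0) :
    ∃ N : ℤ, N ≠ 0 ∧ D ∣ (N : Algebra.adjoin ℤ ({α} : Set K)) := by
  have hαZ : IsAlgebraic ℤ α := (IsFractionRing.isAlgebraic_iff ℤ ℚ K).mpr hα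
  have hDZ : IsAlgebraic ℤ (D : K) :=
    Algebra.adjoin_le (S := Subalgebra.algebraicClosure ℤ K) (Set.singleton_subset_iff.mpr hαZ) D.2
  have hDZ' : IsAlgebraic ℤ D :=
    (isAlgebraic_algebraMap_iff (A := K) Subtype.val_injective).mp hDZ
  obtain ⟨N, hN, hdvd⟩ := hDZ'.exists_nonzero_dvd (mem_nonZeroDivisors_of_ne_zero hD)
  exact ⟨N, hN, by simpa using hdvd⟩

theorem mainTheorem1 {K : Type*} [Field K] [CharZero K] (α : K) (hα : IsAlgebraic ℚ α)
    (hK : IntermediateField.adjoin ℚ ({α} : Set K) = ⊤) (n : ℕ)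
    (𝔞 : Ideal (MvPolynomial (Fin n) K)) (m : ℕ)
    (f : Fin m → MvPolynomial (Fin n) (Algebra.adjoin ℤ ({α} : Set K)))
    (hf : 𝔞 = Ideal.span (Set.range fun j =>
      MvPolynomial.map (algebraMap (Algebra.adjoin ℤ ({α} : Set K)) K) (f j))) :
    {p : ℕ | ∃ (_ : Fact p.Prime) (S₁ S₂ : (ZMod p)[X])
      (h : IsGoodSplitting p (minpoly ℚ α) S₁ S₂) (i : ℤ),
      affineHilbertFunction 𝔞 i ≠ affineHilbertFunction (reducedIdeal hα h f) i}.Finite := by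
  obtain ⟨D, hD, N, hN⟩ := exists_hasNormalForms_localizationAway (Ideal.span (Set.range f))
  obtain ⟨M, hM, hDM⟩ := exists_int_ne_zero_dvd hα hD
  refine M.natAbs.divisors.finite_toSet.subset ?_
  rintro p ⟨hp, S₁, S₂, h, i, hne⟩
  rw [Finset.mem_coe, Nat.mem_divisors]
  refine ⟨?_, Int.natAbs_ne_zero.mpr hM⟩
  have hψ : psi hα h D = 0 := by
    by_contra hψ
    have hK0 : algebraMap (Algebra.adjoin ℤ ({α} : Set K)) K D ≠ 0 :=
      (map_ne_zero_iff _ Subtype.val_injective).mpr hD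
    have h1 := affineHilbertFunction_map_eq_card hN _ hK0 i
    have h2 := affineHilbertFunction_map_eq_card hN _ hψ i
    rw [Ideal.map_span, ← Set.range_comp] at h1 h2
    rw [hf, reducedIdeal] at hne
    exact hne (h1.trans h2.symm)
  have hM0 : ((M : ℤ) : ZMod p) = 0 := by
    rw [← map_intCast (psi hα h)]
    exact zero_dvd_iff.mp (hψ ▸ map_dvd (psi hα h) hDM)
  exact Int.natCast_dvd.mp ((ZMod.intCast_zmod_eq_zero_iff_dvd M p).mp hM0)
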